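/- A permutation on a finite poset $P$ with $N$ elements is a bijection $\sigma\colon\{1,\dots,N\}\to P$, written as the list $(\sigma_1,\dots,\sigma_N)$. For a poset $Q$ on $k$ elements and a permutation $\pi$ on $Q$ (a pattern), $\sigma$ contains $\pi$ if there are positions $i_1<\cdots<i_k$ such that for all $1\le a<b\le k$ the order relation (less than, greater than, or incomparable) between $\sigma_{i_a}$ and $\sigma_{i_b}$ is the same as that between $\pi_a$ and $\pi_b$; otherwise $\sigma$ avoids $\pi$. Let $Av_P(\pi)$ be the number of permutations on $P$ that avoid $\pi$. Two different patterns $\pi,\pi'$ (patterns being identified when an isomorphism of their posets carries one list to the other) are Wilf equivalent for $P$ if $Av_P(\pi)=Av_P(\pi')$. Let $\mathbb{B}_n$ be the Boolean lattice of all subsets of $\{1,\dots,n\}$ ordered by inclusion, and write $Av_n(\pi)=Av_{\mathbb{B}_n}(\pi)$. Let $123$ and $132$ denote the permutations $(1,2,3)$ and $(1,3,2)$ on the chain $\{1<2<3\}$. For every $n\ge 3$, $$Av_n(132)<Av_n(123).$$ In particular, the patterns $123$ and $132$ are not Wilf equivalent for $\mathbb{B}_n$ for any $n\ge 3$. -/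

import Mathlib

/-- A permutation on the finite poset `P`: a bijection from the set of positions
(here `0, …, |P| - 1`) to `P`, thought of as a list of the elements of `P`. -/
abbrev PosetPerm (P : Type*) [Fintype P] : Type _ := Fin (Fintype.card P) ≃ P

namespace PosetPerm

/-- `σ` contains the pattern `π`: there are entries of `σ` at increasing positions such that, for
all positions `a < b` of `π`, the order relation (less, greater or incomparable) between the
selected entries number `a` and `b` is the one between `π a` and `π b`. The entries of a permutation
are distinct, so agreement on "less" and on "greater" includes agreement on "incomparable". -/
def Contains {P Q : Type*} [PartialOrder P] [Fintype P] [PartialOrder Q] [Fintype Q]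
    (σ : PosetPerm P) (π : PosetPerm Q) : Prop :=
  ∃ i : Fin (Fintype.card Q) → Fin (Fintype.card P), StrictMono i ∧
    ∀ a b : Fin (Fintype.card Q), a < b →
      (σ (i a) < σ (i b) ↔ π a < π b) ∧ (σ (i b) < σ (i a) ↔ π b < π a)

/-- `σ` avoids the pattern `π`. -/
def Avoids {P Q : Type*} [PartialOrder P] [Fintype P] [PartialOrder Q] [Fintype Q]
    (σ : PosetPerm P) (π : PosetPerm Q) : Prop :=
  ¬ σ.Contains π

/-- `π` and `π'` are the same pattern: an isomorphism of the underlying posets carries the list `π`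
to the list `π'`. -/
def SamePattern {Q Q' : Type*} [PartialOrder Q] [Fintype Q] [PartialOrder Q'] [Fintype Q']
    (π : PosetPerm Q) (π' : PosetPerm Q') : Prop :=
  ∃ e : Q ≃o Q', ∀ (j : Fin (Fintype.card Q)) (j' : Fin (Fintype.card Q')),
    (j : ℕ) = (j' : ℕ) → e (π j) = π' j'

/-- A permutation of the chain with `k` elements, given by its list of values, as a pattern. -/
def ofPerm {k : ℕ} (τ : Equiv.Perm (Fin k)) : PosetPerm (Fin k) :=
  (finCongr (Fintype.card_fin k)).trans τ

/-- The pattern `123` (with values and positions counted from `0`: the list `0, 1, 2`). -/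
def pattern123 : PosetPerm (Fin 3) := ofPerm (Equiv.refl (Fin 3))

/-- The pattern `132` (with values and positions counted from `0`: the list `0, 2, 1`). -/
def pattern132 : PosetPerm (Fin 3) := ofPerm (Equiv.swap 1 2)

end PosetPerm

/-- The number of permutations on the finite poset `P` that avoid the pattern `π`. -/
noncomputable def avoidCount (P : Type*) [PartialOrder P] [Fintype P]
    {Q : Type*} [PartialOrder Q] [Fintype Q] (π : PosetPerm Q) : ℕ :=
  Nat.card {σ : PosetPerm P // σ.Avoids π}

/-- Two different patterns are Wilf equivalent for `P` if equally many permutations on `P`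
avoid them. -/
def WilfEquivalent (P : Type*) [PartialOrder P] [Fintype P]
    {Q Q' : Type*} [PartialOrder Q] [Fintype Q] [PartialOrder Q'] [Fintype Q']
    (π : PosetPerm Q) (π' : PosetPerm Q') : Prop :=
  ¬ π.SamePattern π' ∧ avoidCount P π = avoidCount P π'

/-- The Boolean lattice: all subsets of an `n`-element set, ordered by inclusion. -/
abbrev BooleanLattice (n : ℕ) : Type := Finset (Fin n)

/-! A Simion–Schmidt type map sends `132`-avoiders to `123`-avoiders over any finite poset. Letters
above no earlier letter stay in place. The other letters are treated from right to left: each is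
slid through the word already built on its right, so that its position receives a letter below
nothing further right. The output avoids `123` (`avoids123_transfer`). If the source avoids `132`,
every slide can be undone (`unslide_slide`), hence the map is injective (`transfer_injOn`).

The inequality is strict because undoing a slide may carry a large letter behind some `c` that is
not above the first letter, and so create an increasing triple ending in that large letter. A
`123`-avoider for which this happens is outside the image (`transfer_ne`); three coatoms of the
Boolean lattice provide one. -/

namespace BooleanPatterns

open List

/-! ### Avoidance of `123` and `132` in words over a poset -/

section Words

variable {α : Type*} [PartialOrder α]

/-- The word `l` has no subword `a, b, c` with `a < b < c`, and no subword `b, c` with `b < c` and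
`b ∈ U`. The set `U` plays the role of the elements above some letter preceding `l`. -/
def Avoids123 (U : Set α) (l : List α) : Prop :=
  l.Pairwise (fun b c => b ∈ U → ¬ b < c) ∧ l.Triplewise (fun a b c => ¬ (a < b ∧ b < c))

/-- The word `l` has no subword `a, c, b` with `a < b < c`, and no subword `c, b` with `b < c` and
`b ∈ U`. -/
def Avoids132 (U : Set α) (l : List α) : Prop :=
  l.Pairwise (fun c b => b ∈ U → ¬ b < c) ∧ l.Triplewise (fun a c b => ¬ (a < b ∧ b < c))

theorem avoids123_nil (U : Set α) : Avoids123 U [] := ⟨Pairwise.nil, Triplewise.nil⟩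

/-- A triple starting at `x` is an ascent whose lower letter is in `Set.Ioi x`, so enlarging `U`
records all that later letters need to know about `x`. -/
theorem avoids123_cons {U : Set α} {x : α} {l : List α} :
    Avoids123 U (x :: l) ↔
      (x ∈ U → ∀ y ∈ l, ¬ x < y) ∧ Avoids123 (U ∪ Set.Ioi x) l := by
  simp only [Avoids123, pairwise_cons, triplewise_cons]
  constructor
  · rintro ⟨⟨h1, h2⟩, h3, h4⟩
    refine ⟨fun hx y hy => h1 y hy hx, (h2.and h3).imp ?_, h4⟩
    rintro b c ⟨hb, hb'⟩ (h | h)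
    · exact hb h
    · exact fun hc => hb' ⟨h, hc⟩
  · rintro ⟨h1, h2, h3⟩
    exact ⟨⟨fun y hy hx => h1 hx y hy, h2.imp fun h hb => h (Or.inl hb)⟩,
      h2.imp fun h hb => h (Or.inr hb.1) hb.2, h3⟩

theorem avoids132_cons {U : Set α} {x : α} {l : List α} :
    Avoids132 U (x :: l) ↔
      (∀ y ∈ l, y ∈ U → ¬ y < x) ∧ Avoids132 (U ∪ Set.Ioi x) l := by
  simp only [Avoids132, pairwise_cons, triplewise_cons]
  constructor
  · rintro ⟨⟨h1, h2⟩, h3, h4⟩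
    refine ⟨h1, (h2.and h3).imp ?_, h4⟩
    rintro b c ⟨hb, hb'⟩ (h | h)
    · exact hb h
    · exact fun hc => hb' ⟨h, hc⟩
  · rintro ⟨h1, h2, h3⟩
    exact ⟨⟨h1, h2.imp fun h hb => h (Or.inl hb)⟩,
      h2.imp fun h hb => h (Or.inr hb.1) hb.2, h3⟩

theorem union_Ioi_of_mem {U : Set α} (hU : IsUpperSet U) {x : α} (hx : x ∈ U) :
    U ∪ Set.Ioi x = U :=
  Set.union_eq_left.2 fun _ hy => hU (le_of_lt hy) hx

theorem isUpperSet_union_Ioi {U : Set α} (hU : IsUpperSet U) (x : α) :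
    IsUpperSet (U ∪ Set.Ioi x) :=
  hU.union (isUpperSet_Ioi x)

/-! ### Sliding a hole through a word -/

open Classical in
/-- Read the word from right to left, carrying a letter, initially `h`, and exchange the carried
letter with every larger letter met. The result is the last carried letter and the new word. -/
noncomputable def slide (h : α) : List α → α × List α
  | [] => (h, [])
  | y :: l =>
    if (slide h l).1 < y then (y, (slide h l).1 :: (slide h l).2)
    else ((slide h l).1, y :: (slide h l).2)

open Classical in
/-- Read the word from left to right, carrying a letter, initially `h`, and exchange the carried
letter with every smaller letter of `U` met. -/
noncomputable def unslide (U : Set α) (h : α) : List α → α × List α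
  | [] => (h, [])
  | y :: l =>
    if y < h ∧ y ∈ U then ((unslide U y l).1, h :: (unslide U y l).2)
    else ((unslide U h l).1, y :: (unslide U h l).2)

theorem slide_perm (h : α) (l : List α) : (slide h l).1 :: (slide h l).2 ~ h :: l := by
  induction l with
  | nil => exact Perm.refl _
  | cons y l ih =>
    rw [slide]
    split_ifs
    · exact (ih.cons y).trans (Perm.swap _ _ _)
    · exact (Perm.swap _ _ _).trans ((ih.cons y).trans (Perm.swap _ _ _))

theorem le_slide (h : α) (l : List α) : h ≤ (slide h l).1 := by
  induction l with
  | nil => exact le_rfl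
  | cons y l ih =>
    rw [slide]
    split_ifs with hy
    · exact ih.trans hy.le
    · exact ih

/-- The carried letter only grows, so a letter once left behind never lies above it later. -/
theorem not_slide_lt (h : α) (l : List α) : ∀ y ∈ (slide h l).2, ¬ (slide h l).1 < y := by
  induction l with
  | nil => simp [slide]
  | cons y l ih =>
    rw [slide]
    split_ifs with hy
    · intro z hz
      rcases mem_cons.1 hz with rfl | hz
      · exact hy.asymm
      · exact fun h => ih z hz (hy.trans h)
    · intro z hz
      rcases mem_cons.1 hz with rfl | hz
      · exact hy
      · exact ih z hz

/-- Where `slide` exchanges, the letter left behind is at least `x`, hence in `U`, and `unslide`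
exchanges back. `hmin` is what `132`-avoidance supplies. -/
theorem unslide_slide {U : Set α} {x : α} {l : List α} (hl : Avoids123 U l)
    (hmin : ∀ y ∈ l, y ∈ U → ¬ y < x) (hU : IsUpperSet U) (hx : x ∈ U) :
    unslide U (slide x l).1 (slide x l).2 = (x, l) := by
  induction l with
  | nil => rfl
  | cons y l ih =>
    have hl' : Avoids123 U l := ⟨(pairwise_cons.1 hl.1).2, (triplewise_cons.1 hl.2).2⟩
    specialize ih hl' fun z hz => hmin z (mem_cons_of_mem _ hz)
    rw [slide]
    split_ifs with hy
    · simp only [unslide]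
      rw [if_pos ⟨hy, hU (le_slide x l) hx⟩, ih]
    · simp only [unslide]
      rw [if_neg, ih]
      rintro ⟨hlt, hyU⟩
      -- The carried letter is `x` or comes from `l`; a smaller `y ∈ U` contradicts `hmin` in the
      -- first case and starts a forbidden ascent in the second.
      rcases mem_cons.1 ((slide_perm x l).subset mem_cons_self) with h | h
      · exact hmin y mem_cons_self hyU (h ▸ hlt)
      · exact (pairwise_cons.1 hl.1).1 _ h hyU hlt

theorem avoids123_slide {U : Set α} {x : α} {l : List α} (hl : Avoids123 U l)
    (hU : IsUpperSet U) (hx : x ∈ U) : Avoids123 U (slide x l).2 := by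
  induction l generalizing U with
  | nil => exact hl
  | cons y l ih =>
    rw [avoids123_cons] at hl
    rw [slide]
    split_ifs with hy
    · have hsU : (slide x l).1 ∈ U := hU (le_slide x l) hx
      have hyU : y ∈ U := hU hy.le hsU
      rw [union_Ioi_of_mem hU hyU] at hl
      refine avoids123_cons.2 ⟨fun _ => not_slide_lt x l, ?_⟩
      rw [union_Ioi_of_mem hU hsU]
      exact ih hl.2 hU hx
    · refine avoids123_cons.2 ⟨fun hyU z hz hyz => ?_,
        ih hl.2 (isUpperSet_union_Ioi hU y) (Or.inl hx)⟩
      rcases mem_cons.1 ((slide_perm x l).subset (mem_cons_of_mem _ hz)) with rfl | hzl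
      -- Here `z` is the inserted letter. If it is also the final carried letter, cancelling it
      -- shows that the new word permutes `l`; otherwise the carried letter is in `l` and above `y`.
      · rcases mem_cons.1 ((slide_perm z l).subset mem_cons_self) with h | h
        · have hp := slide_perm z l
          rw [h] at hp
          exact hl.1 hyU z (((perm_cons z).1 hp).subset hz) hyz
        · exact hl.1 hyU _ h (hyz.trans_le (le_slide z l))
      · exact hl.1 hyU z hzl hyz

open Classical in
/-- Turn a `132`-avoiding word into a `123`-avoiding one: keep the letters that lie above no earlier
letter, and slide all others from right to left. -/
noncomputable def transfer (U : Set α) : List α → List α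
  | [] => []
  | x :: l =>
    if x ∈ U then (slide x (transfer U l)).1 :: (slide x (transfer U l)).2
    else x :: transfer (U ∪ Set.Ioi x) l

theorem transfer_cons_of_mem {U : Set α} {x : α} (hx : x ∈ U) (l : List α) :
    transfer U (x :: l) =
      (slide x (transfer U l)).1 :: (slide x (transfer U l)).2 := by
  rw [transfer, if_pos hx]

theorem transfer_cons_of_notMem {U : Set α} {x : α} (hx : x ∉ U) (l : List α) :
    transfer U (x :: l) = x :: transfer (U ∪ Set.Ioi x) l := by
  rw [transfer, if_neg hx]

theorem transfer_perm (U : Set α) (l : List α) : transfer U l ~ l := by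
  induction l generalizing U with
  | nil => exact Perm.refl _
  | cons x l ih =>
    by_cases hx : x ∈ U
    · rw [transfer_cons_of_mem hx]
      exact (slide_perm _ _).trans ((ih U).cons x)
    · rw [transfer_cons_of_notMem hx]
      exact (ih _).cons x

theorem avoids123_transfer {U : Set α} (hU : IsUpperSet U) {l : List α} :
    Avoids123 U (transfer U l) := by
  induction l generalizing U with
  | nil => exact avoids123_nil U
  | cons x l ih =>
    by_cases hx : x ∈ U
    · rw [transfer_cons_of_mem hx]
      refine avoids123_cons.2 ⟨fun _ => not_slide_lt _ _, ?_⟩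
      rw [union_Ioi_of_mem hU (hU (le_slide _ _) hx)]
      exact avoids123_slide (ih hU) hU hx
    · rw [transfer_cons_of_notMem hx]
      exact avoids123_cons.2 ⟨fun h => absurd h hx, ih (isUpperSet_union_Ioi hU x)⟩

theorem unslide_of_transfer_eq {U : Set α} (hU : IsUpperSet U) {x f : α} {l r : List α}
    (hl : Avoids132 U (x :: l)) (hx : x ∈ U) (h : transfer U (x :: l) = f :: r) :
    unslide U f r = (x, transfer U l) := by
  rw [transfer_cons_of_mem hx, cons.injEq] at h
  rw [← h.1, ← h.2]
  exact unslide_slide (avoids123_transfer hU)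
    (fun y hy => (avoids132_cons.1 hl).1 y ((transfer_perm U l).subset hy)) hU hx

theorem head_mem_iff_of_transfer_eq {U : Set α} (hU : IsUpperSet U) {x f : α} {l r : List α}
    (h : transfer U (x :: l) = f :: r) : x ∈ U ↔ f ∈ U := by
  by_cases hx : x ∈ U
  · rw [transfer_cons_of_mem hx, cons.injEq] at h
    exact iff_of_true hx (h.1 ▸ hU (le_slide _ _) hx)
  · rw [transfer_cons_of_notMem hx, cons.injEq] at h
    rw [h.1]

/-- The head of the output shows which branch of `transfer` was taken, since sliding keeps it inside
the upper set `U`; in the sliding branch `unslide` recovers both the head and the transferred tail.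
-/
theorem transfer_injOn {U : Set α} (hU : IsUpperSet U) {l m : List α} (hl : Avoids132 U l)
    (hm : Avoids132 U m) (h : transfer U l = transfer U m) : l = m := by
  induction l generalizing U m with
  | nil =>
    have := transfer_perm U m
    rw [← h] at this
    exact (this.symm.eq_nil).symm
  | cons x l ih =>
    cases m with
    | nil =>
      have := transfer_perm U (x :: l)
      rw [h] at this
      exact this.symm.eq_nil
    | cons y m =>
      by_cases hx : x ∈ U
      · have hy : y ∈ U :=
          (head_mem_iff_of_transfer_eq hU (h.symm.trans (transfer_cons_of_mem hx l))).2
            (hU (le_slide _ _) hx)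
        have h1 := unslide_of_transfer_eq hU hl hx (transfer_cons_of_mem hx l)
        have h2 := unslide_of_transfer_eq hU hm hy (h.symm.trans (transfer_cons_of_mem hx l))
        rw [h1, Prod.mk.injEq] at h2
        have hl' := (avoids132_cons.1 hl).2
        have hm' := (avoids132_cons.1 hm).2
        rw [union_Ioi_of_mem hU hx] at hl'
        rw [union_Ioi_of_mem hU hy] at hm'
        rw [h2.1, ih hU hl' hm' h2.2]
      · have hy : y ∉ U := by
          rw [head_mem_iff_of_transfer_eq hU (h.symm.trans (transfer_cons_of_notMem hx l))]
          exact hx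
        rw [transfer_cons_of_notMem hx, transfer_cons_of_notMem hy, cons.injEq] at h
        obtain ⟨rfl, h⟩ := h
        rw [ih (isUpperSet_union_Ioi hU x) (avoids132_cons.1 hl).2 (avoids132_cons.1 hm).2 h]

/-! ### A `123`-avoiding word that is not obtained by `transfer` -/

theorem unslide_append {U : Set α} (h : α) {e : List α} (he : ∀ y ∈ e, y ∉ U) (l : List α) :
    unslide U h (e ++ l) = ((unslide U h l).1, e ++ (unslide U h l).2) := by
  induction e with
  | nil => rfl
  | cons y e ih =>
    rw [cons_append, unslide, if_neg fun h => he y mem_cons_self h.2,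
      ih fun z hz => he z (mem_cons_of_mem _ hz)]
    rfl

/-- Undoing the slide that put `t` second passes over `e` and `c`, which are not above `a`,
exchanges `t` with `b₁`, and leaves `b₂`. The transferred tail would be `e, c, t, b₂`, which
contains `e₀ < c < t`. -/
theorem transfer_ne {a t c b₁ b₂ e₀ : α} {e l : List α} (hl : Avoids132 ∅ l)
    (hat : a < t) (hct : c < t) (hbt : b₁ < t) (hab : a < b₁) (hac : ¬ a < c) (hb : ¬ b₂ < b₁)
    (he : ∀ y ∈ e, ¬ a < y) (he₀ : e₀ ∈ e) (hec : e₀ < c) :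
    transfer ∅ l ≠ a :: t :: (e ++ [c, b₁, b₂]) := by
  intro h
  have hU : IsUpperSet (Set.Ioi a) := isUpperSet_Ioi a
  obtain _ | ⟨x, l⟩ := l
  · cases h
  rw [transfer_cons_of_notMem (Set.notMem_empty x), cons.injEq, Set.empty_union] at h
  obtain ⟨rfl, h⟩ := h
  replace hl := (avoids132_cons.1 hl).2
  rw [Set.empty_union] at hl
  obtain _ | ⟨y, l⟩ := l
  · cases h
  have hy : y ∈ Set.Ioi x := (head_mem_iff_of_transfer_eq hU h).2 hat
  have h1 := unslide_of_transfer_eq hU hl hy h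
  rw [unslide_append t (U := Set.Ioi x) he, unslide, if_neg fun h => hac h.2, unslide,
    if_pos ⟨hbt, hab⟩, unslide, if_neg fun h => hb h.1, unslide, Prod.mk.injEq] at h1
  have h2 : Avoids123 (Set.Ioi x) (transfer (Set.Ioi x) l) := avoids123_transfer hU
  rw [← h1.2] at h2
  have h3 := (triplewise_append.1 h2.2).2.2.1 e₀ he₀
  exact (pairwise_cons.1 h3).1 t mem_cons_self ⟨hec, hct⟩

/-- After `t`, letters above `a` can only be among `c, b₁, b₂`, which have no ascent. The word after
`t` consists of two ascent-free blocks, and a triple has two consecutive letters in one of them. -/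
theorem avoids123_example {a t c b₁ b₂ : α} {e : List α} (ht : ∀ y, ¬ t < y)
    (hcb₁ : ¬ c < b₁) (hcb₂ : ¬ c < b₂) (hb : ¬ b₁ < b₂) (he : ∀ y ∈ e, ¬ a < y)
    (hdec : e.Pairwise fun x y => ¬ x < y) :
    Avoids123 ∅ (a :: t :: (e ++ [c, b₁, b₂])) := by
  have hs : [c, b₁, b₂].Pairwise fun x y => ¬ x < y := by simp [hcb₁, hcb₂, hb]
  refine ⟨pairwise_of_forall fun _ _ h => absurd h (Set.notMem_empty _), ?_⟩
  simp only [triplewise_cons (l := t :: _), triplewise_cons (a := t)]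
  refine ⟨pairwise_cons.2 ⟨fun y _ h => ht y h.2, pairwise_append.2 ⟨?_, ?_, ?_⟩⟩, ?_, ?_⟩
  · exact hdec.imp fun h h' => h h'.2
  · exact hs.imp fun h h' => h h'.2
  · exact fun y hy z _ h => he y hy h.1
  · exact pairwise_of_forall fun y _ h => ht y h.1
  · refine triplewise_append.2 ⟨?_, ?_, ?_, ?_⟩
    · clear he
      induction e with
      | nil => exact Triplewise.nil
      | cons y e ih =>
        rw [pairwise_cons] at hdec
        exact triplewise_cons.2 ⟨hdec.2.imp fun h h' => h h'.2, ih hdec.2⟩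
    · simp [hcb₁]
    · exact fun z _ => hs.imp fun h h' => h h'.2
    · exact fun z _ => hdec.imp fun h h' => h h'.1

/-- Every finite set of a poset can be listed without increasing pairs. -/
theorem exists_decreasing_list (s : Finset α) :
    ∃ l : List α, l.Nodup ∧ (∀ x, x ∈ l ↔ x ∈ s) ∧ l.Pairwise fun x y => ¬ x < y := by
  classical
  induction s using Finset.strongInduction with
  | H s ih =>
    rcases s.eq_empty_or_nonempty with rfl | hs
    · exact ⟨[], nodup_nil, by simp, Pairwise.nil⟩
    · obtain ⟨m, hm⟩ := s.exists_maximal hs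
      obtain ⟨l, h1, h2, h3⟩ := ih (s.erase m) (Finset.erase_ssubset hm.1)
      refine ⟨m :: l, nodup_cons.2 ⟨by simp [h2], h1⟩, fun x => ?_, pairwise_cons.2 ⟨?_, h3⟩⟩
      · rw [mem_cons, h2, Finset.mem_erase]
        constructor
        · rintro (rfl | h)
          exacts [hm.1, h.2]
        · exact fun h => or_iff_not_imp_left.2 fun h' => ⟨h', h⟩
      · exact fun y hy => hm.not_gt (Finset.mem_of_mem_erase ((h2 y).1 hy))

end Words

/-! ### Permutations as words -/

section Permutations

variable {P : Type*} [PartialOrder P] [Fintype P]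

theorem contains_iff {σ : PosetPerm P} {τ : Equiv.Perm (Fin 3)} :
    σ.Contains (PosetPerm.ofPerm τ) ↔ ∃ i j k, i < j ∧ j < k ∧
      ((σ i < σ j ↔ τ 0 < τ 1) ∧ (σ j < σ i ↔ τ 1 < τ 0)) ∧
      ((σ i < σ k ↔ τ 0 < τ 2) ∧ (σ k < σ i ↔ τ 2 < τ 0)) ∧
      ((σ j < σ k ↔ τ 1 < τ 2) ∧ (σ k < σ j ↔ τ 2 < τ 1)) := by
  constructor
  · rintro ⟨f, hf, h⟩
    exact ⟨f (0 : Fin 3), f (1 : Fin 3), f (2 : Fin 3), hf (show (0 : Fin 3) < 1 by decide),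
      hf (show (1 : Fin 3) < 2 by decide), h (0 : Fin 3) (1 : Fin 3) (by decide),
      h (0 : Fin 3) (2 : Fin 3) (by decide), h (1 : Fin 3) (2 : Fin 3) (by decide)⟩
  · rintro ⟨i, j, k, hij, hjk, h1, h2, h3⟩
    refine ⟨fun a : Fin 3 => ![i, j, k] a, ?_, ?_⟩
    · intro (a : Fin 3) (b : Fin 3) hab
      change a < b at hab
      have hik := hij.trans hjk
      fin_cases a <;> fin_cases b <;> first | exact absurd hab (by decide) | assumption
    · intro (a : Fin 3) (b : Fin 3) hab
      change a < b at hab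
      fin_cases a <;> fin_cases b <;> first | exact absurd hab (by decide) | assumption

theorem triplewise_ofFn {α : Type*} {n : ℕ} {f : Fin n → α} {p : α → α → α → Prop} :
    (ofFn f).Triplewise p ↔ ∀ i j k, i < j → j < k → p (f i) (f j) (f k) := by
  rw [triplewise_iff_getElem]
  simp only [List.getElem_ofFn, length_ofFn]
  exact ⟨fun h i j k hij hjk => h i j k hij hjk k.2,
    fun h i j k hij hjk hk => h _ _ _ hij hjk⟩

theorem avoids_pattern123_iff {σ : PosetPerm P} :
    σ.Avoids PosetPerm.pattern123 ↔ Avoids123 ∅ (ofFn σ) := by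
  rw [Avoids123, and_iff_right (pairwise_of_forall fun _ _ h => absurd h (Set.notMem_empty _)),
    triplewise_ofFn, PosetPerm.Avoids, PosetPerm.pattern123, contains_iff]
  constructor
  · rintro h i j k hij hjk ⟨h1, h2⟩
    refine h ⟨i, j, k, hij, hjk, ?_⟩
    simp [h1, h2, h1.trans h2, h1.asymm, h2.asymm, (h1.trans h2).asymm]
  · rintro h ⟨i, j, k, hij, hjk, ⟨h1, -⟩, -, h3, -⟩
    exact h i j k hij hjk ⟨h1.2 (by decide), h3.2 (by decide)⟩

theorem avoids_pattern132_iff {σ : PosetPerm P} :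
    σ.Avoids PosetPerm.pattern132 ↔ Avoids132 ∅ (ofFn σ) := by
  rw [Avoids132, and_iff_right (pairwise_of_forall fun _ _ h => absurd h (Set.notMem_empty _)),
    triplewise_ofFn, PosetPerm.Avoids, PosetPerm.pattern132, contains_iff]
  have h01 : Equiv.swap (1 : Fin 3) 2 0 = 0 := by decide
  constructor
  · rintro h i j k hij hjk ⟨h1, h2⟩
    refine h ⟨i, j, k, hij, hjk, ?_⟩
    simp [h01, h1, h2, h1.trans h2, h1.asymm, h2.asymm, (h1.trans h2).asymm]
  · rintro h ⟨i, j, k, hij, hjk, -, ⟨h2, -⟩, -, h3⟩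
    exact h i j k hij hjk ⟨h2.2 (by decide), h3.2 (by decide)⟩

theorem exists_ofFn_eq {P : Type*} [Fintype P] {l : List P} (hl : l.Nodup) (hmem : ∀ x, x ∈ l) :
    ∃ σ : PosetPerm P, ofFn σ = l := by
  classical
  have hc : Fintype.card P = l.length := by
    rw [← Fintype.card_congr (hl.getEquivOfForallMemList l hmem), Fintype.card_fin]
  refine ⟨(finCongr hc).trans (hl.getEquivOfForallMemList l hmem), ?_⟩
  refine ext_getElem (by simp [hc]) fun i h1 h2 => ?_
  simp

theorem exists_transfer (σ : PosetPerm P) : ∃ τ : PosetPerm P, ofFn τ = transfer ∅ (ofFn σ) := by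
  have h := transfer_perm ∅ (ofFn σ)
  refine exists_ofFn_eq (h.nodup_iff.2 (nodup_ofFn.2 σ.injective)) fun x => ?_
  rw [h.mem_iff, mem_ofFn]
  exact σ.surjective x

/-- If some `123`-avoiding word is not obtained by `transfer`, then more permutations avoid `123`
than `132`. -/
theorem avoidCount_lt {w : List P} (hw : w.Nodup) (hmem : ∀ x, x ∈ w) (hav : Avoids123 ∅ w)
    (hne : ∀ l, Avoids132 ∅ l → transfer ∅ l ≠ w) :
    avoidCount P PosetPerm.pattern132 < avoidCount P PosetPerm.pattern123 := by
  classical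
  choose T hT using exists_transfer (P := P)
  obtain ⟨τ, rfl⟩ := exists_ofFn_eq hw hmem
  rw [avoidCount, avoidCount, Nat.card_eq_fintype_card, Nat.card_eq_fintype_card]
  refine Fintype.card_lt_of_injective_of_notMem
    (fun σ => ⟨T σ.1, avoids_pattern123_iff.2 (hT σ.1 ▸ avoids123_transfer isUpperSet_empty)⟩)
    ?_ (b := ⟨τ, avoids_pattern123_iff.2 hav⟩) ?_
  · intro σ σ' h
    have h' : T σ.1 = T σ'.1 := congrArg Subtype.val h
    refine Subtype.ext (DFunLike.coe_injective (ofFn_injective ?_))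
    refine transfer_injOn isUpperSet_empty (avoids_pattern132_iff.1 σ.2)
      (avoids_pattern132_iff.1 σ'.2) ?_
    rw [← hT, ← hT, h']
  · rintro ⟨σ, h⟩
    have h' : T σ.1 = τ := congrArg Subtype.val h
    exact hne _ (avoids_pattern132_iff.1 σ.2) (by rw [← hT, h'])

end Permutations

/-! ### The missed word in the Boolean lattice -/

theorem avoidCount_booleanLattice_lt {n : ℕ} (hn : 3 ≤ n) :
    avoidCount (BooleanLattice n) PosetPerm.pattern132 <
      avoidCount (BooleanLattice n) PosetPerm.pattern123 := by
  -- The roles are `a = {i, j}ᶜ`, `t = ⊤`, `c = {k}ᶜ`, `b₁ = {i}ᶜ`, `b₂ = {j}ᶜ`, `e₀ = ⊥`. Only `⊤`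
  -- and two coatoms lie above `a`, so all remaining sets can go into `e`.
  obtain ⟨i, j, k, hij, hik, hjk⟩ : ∃ i j k : Fin n, i ≠ j ∧ i ≠ k ∧ j ≠ k :=
    ⟨⟨0, by omega⟩, ⟨1, by omega⟩, ⟨2, by omega⟩, by simp, by simp, by simp⟩
  have hco : ∀ {x y : Fin n}, x ≠ y → ¬ ({x}ᶜ : Finset (Fin n)) < {y}ᶜ := by
    intro x y hxy h
    have : y ∈ ({x}ᶜ : Finset (Fin n)) := by simp [hxy.symm]
    simpa using h.le this
  have hco' : ∀ {x y : Fin n}, x ≠ y → ({x}ᶜ : Finset (Fin n)) ≠ {y}ᶜ := by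
    intro x y hxy h
    exact hxy (Finset.singleton_injective (compl_injective h))
  have hct : ∀ x : Fin n, ({x}ᶜ : Finset (Fin n)) < ⊤ := fun x =>
    lt_top_iff_ne_top.2 fun h => by simp at h
  have hai : ({i, j}ᶜ : Finset (Fin n)) < {i}ᶜ :=
    compl_lt_compl_iff_lt.2 (by
      rw [Finset.ssubset_iff]; exact ⟨j, by simp [hij.symm], by
        intro; simp; tauto⟩)
  have haj : ({i, j}ᶜ : Finset (Fin n)) < {j}ᶜ :=
    compl_lt_compl_iff_lt.2 (by
      rw [Finset.ssubset_iff]; exact ⟨i, by simp [hij], by intro; simp⟩)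
  have hak : ¬ ({i, j}ᶜ : Finset (Fin n)) ≤ {k}ᶜ := by
    rw [compl_le_compl_iff_le, Finset.singleton_subset_iff]
    simp [hik.symm, hjk.symm]
  have hgt : ∀ y : Finset (Fin n), {i, j}ᶜ < y → y = ⊤ ∨ y = {i}ᶜ ∨ y = {j}ᶜ := by
    intro y hy
    have hz : ∀ z, z ≠ i → z ≠ j → z ∈ y := fun z h1 h2 => hy.le (by simp [h1, h2])
    by_cases hi : i ∈ y <;> by_cases hj : j ∈ y
    · refine Or.inl (Finset.eq_univ_iff_forall.2 fun z => ?_)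
      by_cases h1 : z = i <;> by_cases h2 : z = j <;> simp_all
    · refine Or.inr (Or.inr (Finset.ext fun z => ?_))
      by_cases h1 : z = i <;> by_cases h2 : z = j <;> simp_all
    · refine Or.inr (Or.inl (Finset.ext fun z => ?_))
      by_cases h1 : z = i <;> by_cases h2 : z = j <;> simp_all
    · refine absurd (Finset.ext fun z => ?_) hy.ne
      by_cases h1 : z = i <;> by_cases h2 : z = j <;> simp_all
  set s : Finset (Finset (Fin n)) :=
    {y | y ≠ {i, j}ᶜ ∧ y ≠ ⊤ ∧ y ≠ {k}ᶜ ∧ y ≠ {i}ᶜ ∧ y ≠ {j}ᶜ} with hs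
  obtain ⟨e, hnd, hmem, hdec⟩ := exists_decreasing_list s
  simp only [hs, Finset.mem_filter, Finset.mem_univ, true_and] at hmem
  have he : ∀ y ∈ e, ¬ {i, j}ᶜ < y := by
    intro y hy h
    have := (hmem y).1 hy
    have := hgt y h
    tauto
  have hbk : (⊥ : Finset (Fin n)) < {k}ᶜ := by
    refine bot_lt_iff_ne_bot.2 fun h => ?_
    have : i ∈ ({k}ᶜ : Finset (Fin n)) := by simp [hik]
    rw [h] at this
    simp at this
  have hbe : ⊥ ∈ e := by
    have hmk : k ∈ ({i, j}ᶜ : Finset (Fin n)) := by simp [hik.symm, hjk.symm]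
    have hmi : k ∈ ({i}ᶜ : Finset (Fin n)) := by simp [hik.symm]
    have hmj : k ∈ ({j}ᶜ : Finset (Fin n)) := by simp [hjk.symm]
    have hk0 : k ∉ (⊥ : Finset (Fin n)) := by simp
    exact (hmem ⊥).2 ⟨fun h => hk0 (h ▸ hmk), fun h => hk0 (h ▸ Finset.mem_univ k), hbk.ne,
      fun h => hk0 (h ▸ hmi), fun h => hk0 (h ▸ hmj)⟩
  refine avoidCount_lt (w := {i, j}ᶜ :: ⊤ :: (e ++ [{k}ᶜ, {i}ᶜ, {j}ᶜ])) ?_ ?_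
    (avoids123_example (fun y => not_top_lt) (hco hik.symm) (hco hjk.symm) (hco hij) he hdec)
    fun l hl => transfer_ne hl (hai.trans (hct i)) (hct k) (hct i) hai (fun h => hak h.le)
      (hco hij.symm) he hbe hbk
  · have h1 : ({i, j}ᶜ : Finset (Fin n)) ≠ {k}ᶜ := fun h => hak h.le
    have h2 := (hai.trans (hct i)).ne
    have hk := (hct k).ne'
    have hi := (hct i).ne'
    have hj := (hct j).ne'
    simp only [nodup_cons, nodup_append, mem_cons, mem_append, not_mem_nil, or_false, hmem,
      nodup_nil]
    refine ⟨?_, ?_, hnd, ?_, ?_⟩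
    · have := hai.ne
      have := haj.ne
      tauto
    · tauto
    · have := hco' hik.symm
      have := hco' hjk.symm
      have := hco' hij
      tauto
    · rintro a ha b (rfl | rfl | rfl) <;> tauto
  · intro x
    have := hmem x
    simp only [mem_cons, mem_append, not_mem_nil, or_false]
    tauto

end BooleanPatterns

theorem mainTheorem2 (n : ℕ) (hn : 3 ≤ n) :
    avoidCount (BooleanLattice n) PosetPerm.pattern132 <
        avoidCount (BooleanLattice n) PosetPerm.pattern123 ∧
      ¬ WilfEquivalent (BooleanLattice n) PosetPerm.pattern123 PosetPerm.pattern132 := by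
  have h := BooleanPatterns.avoidCount_booleanLattice_lt hn
  exact ⟨h, fun hw => h.ne hw.2.symm⟩
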